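/- **Setting.** For $m\ge 0$ let $H^2_{\mathbb C^m}=\{F(z)=\sum_{n\ge0}A_nz^n:\ A_n\in\mathbb C^m,\ \|F\|^2=\sum_n\|A_n\|^2<\infty\}$ be the $\mathbb C^m$-valued Hardy space on the unit disc $\mathbb D$, and let $S$ be the shift, $(SF)(z)=zF(z)$. An *inner multiplier* $\Theta$ from $\mathbb C^r$ to $\mathbb C^m$ is a bounded analytic function on $\mathbb D$ with values in $\mathcal L(\mathbb C^r,\mathbb C^m)$ such that $F\mapsto\Theta F$ is an isometry from $H^2_{\mathbb C^r}$ into $H^2_{\mathbb C^m}$; its model space is $\mathcal K_\Theta=H^2_{\mathbb C^m}\ominus\Theta H^2_{\mathbb C^r}$. The entries of an inner multiplier of the form $\operatorname{diag}(\theta_1,\dots,\theta_m)$ are scalar inner functions; such a $\theta_i$ is called *rational* if it is a unimodular constant times a finite (possibly empty) product of Blaschke factors $\frac{z-a}{1-\bar a z}$, $|a|<1$. A *defect space* of a closed subspace $\mathcal M\subseteq H^2_{\mathbb C^m}$ is a finite-dimensional subspace $\mathcal F$ with $S\mathcal M\subseteq\mathcal M+\mathcal F$. We say that $\mathcal M$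 is *almost invariant for $S$ with defect $p$* if it has a defect space of dimension $p$; the *minimal defect* of $\mathcal M$ is the smallest dimension of a defect space. A *half-space* is a closed subspace of infinite dimension and infinite codimension. **Proposition.** Let $\Psi=\operatorname{diag}(\psi_1,\dots,\psi_m)$ be a diagonal inner multiplier on $\mathbb C^m$. 1. Let $r\le m$ and let $\Theta$ be an inner multiplier from $\mathbb C^r$ to $\mathbb C^m$. Then $$(\Psi\mathcal K_\Theta)^\perp=\Psi\Theta H^2_{\mathbb C^r}\oplus\mathcal K_\Psi$$ (an orthogonal sum), and this space is almost invariant for $S$ with defect $m$. Its minimal defect equals $m$ if and only if every $\psi_i$ is non-constant and there is no non-zero $v\in\mathbb C^r$ for which the function $z\mapsto\Theta(z)v$ is constant on $\mathbb D$. 2. If $\Theta=\operatorname{diag}(\theta_1,\dots,\theta_m)$ is a diagonal inner multiplier on $\mathbb C^m$ and at least one $\theta_j$ is not rational, then $(\Psi\mathcal K_\Theta)^\perp$ is a half-space and is almost invariant for $S$ with defect $m$. Its minimal defect equals $m$ if and only if all $\psi_i$ and all $\theta_i$ are non-constant. -/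

import Mathlib

open Metric ComplexConjugate

namespace HardyShift

/-- The space `ℂᵐ` with its Euclidean norm. -/
abbrev Cn (m : ℕ) : Type := EuclideanSpace ℂ (Fin m)

/-- The Hardy space `H²(𝔻, ℂᵐ)`: square summable sequences of Taylor coefficients in `ℂᵐ`. -/
abbrev H2 (m : ℕ) : Type := lp (fun _ : ℕ => Cn m) 2

/-- The value `F(z) = ∑ Aₙ zⁿ` of `F = (Aₙ)` at a point `z` of the open unit disc. -/
noncomputable def eval {m : ℕ} (F : H2 m) (z : ℂ) : Cn m := ∑' n : ℕ, z ^ n • F n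

/-- The coefficients of `z F(z)`. -/
def shiftCoeff {m : ℕ} (F : ℕ → Cn m) : ℕ → Cn m
  | 0 => 0
  | n + 1 => F n

theorem memlp_shiftCoeff {m : ℕ} (F : H2 m) : Memℓp (shiftCoeff (F : ℕ → Cn m)) 2 := by
  have h := (memℓp_gen_iff (p := 2) (by norm_num)).1 (lp.memℓp F)
  refine (memℓp_gen_iff (p := 2) (by norm_num)).2 ?_
  exact (summable_nat_add_iff 1).1 h

/-- The forward shift `S` on `H²(𝔻, ℂᵐ)`, that is, `(S F)(z) = z F(z)`. -/
noncomputable def shift (m : ℕ) : H2 m →ₗ[ℂ] H2 m where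
  toFun F := ⟨shiftCoeff F, memlp_shiftCoeff F⟩
  map_add' F G := by
    ext n : 2
    cases n with
    | zero => exact (add_zero (0 : Cn m)).symm
    | succ n => rfl
  map_smul' c F := by
    ext n : 2
    cases n <;> simp [shiftCoeff]

theorem summable_eval {m : ℕ} (F : H2 m) {z : ℂ} (hz : z ∈ ball (0 : ℂ) 1) :
    Summable fun n : ℕ => z ^ n • F n := by
  have hz' : ‖z‖ < 1 := by simpa using hz
  refine Summable.of_norm_bounded (g := fun n : ℕ => ‖z‖ ^ n * ‖F‖)
    ((summable_geometric_of_lt_one (norm_nonneg z) hz').mul_right _) fun n => ?_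
  rw [norm_smul, norm_pow]
  exact mul_le_mul_of_nonneg_left (lp.norm_apply_le_norm (by norm_num) F n) (by positivity)

/-- The coefficientwise definition of the shift is multiplication by the variable. -/
theorem eval_shift {m : ℕ} (F : H2 m) {z : ℂ} (hz : z ∈ ball (0 : ℂ) 1) :
    eval (shift m F) z = z • eval F z := by
  have h := (summable_eval (shift m F) hz).tsum_eq_zero_add
  have h0 : (shift m F) 0 = 0 := rfl
  have h1 : ∀ n, (shift m F) (n + 1) = F n := fun _ => rfl
  unfold eval
  rw [h, h0, ← (summable_eval F hz).tsum_const_smul z]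
  simp only [h1, smul_zero, zero_add, pow_succ', mul_smul]

/-- An inner multiplier: a bounded analytic function `Θ` on the unit disc with values in
`L(ℂʳ, ℂᵐ)` such that multiplication by `Θ` is an isometry of `H²(𝔻, ℂʳ)` into `H²(𝔻, ℂᵐ)`.
The values of `toFun` off the disc play no role. -/
structure InnerMultiplier (r m : ℕ) where
  toFun : ℂ → (Cn r →L[ℂ] Cn m)
  analytic : DifferentiableOn ℂ toFun (ball 0 1)
  bounded : ∃ C : ℝ, ∀ z ∈ ball (0 : ℂ) 1, ‖toFun z‖ ≤ C
  isometry : ∃ T : H2 r →ₗᵢ[ℂ] H2 m,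
    ∀ F : H2 r, ∀ z ∈ ball (0 : ℂ) 1, eval (T F) z = toFun z (eval F z)

namespace InnerMultiplier

/-- The multiplication operator `F ↦ Θ F`. -/
noncomputable def mul {r m : ℕ} (Θ : InnerMultiplier r m) : H2 r →ₗᵢ[ℂ] H2 m :=
  Θ.isometry.choose

theorem eval_mul {r m : ℕ} (Θ : InnerMultiplier r m) (F : H2 r) {z : ℂ}
    (hz : z ∈ ball (0 : ℂ) 1) : eval (Θ.mul F) z = Θ.toFun z (eval F z) :=
  Θ.isometry.choose_spec F z hz

/-- The subspace `Θ K` of `H²(𝔻, ℂᵐ)` for a subspace `K` of `H²(𝔻, ℂʳ)`. -/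
noncomputable def image {r m : ℕ} (Θ : InnerMultiplier r m) (K : Submodule ℂ (H2 r)) :
    Submodule ℂ (H2 m) :=
  K.map Θ.mul.toLinearMap

/-- The model space `K_Θ = H²(𝔻, ℂᵐ) ⊖ Θ H²(𝔻, ℂʳ)`. -/
noncomputable def modelSpace {r m : ℕ} (Θ : InnerMultiplier r m) : Submodule ℂ (H2 m) :=
  (Θ.image ⊤)ᗮ

/-- `Θ(z)` is the diagonal matrix with entries `θ₁(z), …, θₘ(z)` on the disc. -/
def IsDiagonal {m : ℕ} (Θ : InnerMultiplier m m) (θ : Fin m → ℂ → ℂ) : Prop :=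
  ∀ z ∈ ball (0 : ℂ) 1,
    Θ.toFun z = Matrix.toEuclideanCLM (n := Fin m) (𝕜 := ℂ) (Matrix.diagonal fun i => θ i z)

end InnerMultiplier

/-- An inner function is rational if it is a finite Blaschke product (up to a unimodular
constant; the empty product is allowed). -/
def IsRationalInner (θ : ℂ → ℂ) : Prop :=
  ∃ (c : ℂ) (s : Multiset ℂ), ‖c‖ = 1 ∧ (∀ a ∈ s, a ∈ ball (0 : ℂ) 1) ∧
    ∀ z ∈ ball (0 : ℂ) 1, θ z = c * (s.map fun a => (z - a) / (1 - conj a * z)).prod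

/-- A function is constant on the unit disc. -/
def IsConstOnDisc {E : Type*} (f : ℂ → E) : Prop :=
  ∃ c : E, ∀ z ∈ ball (0 : ℂ) 1, f z = c

section AlmostInvariant

variable {H : Type*} [NormedAddCommGroup H] [InnerProductSpace ℂ H]

/-- `D` is a defect space of `M` for `T`: it is finite dimensional and `T M ⊆ M + D`. -/
def IsDefectSpace (T : H →ₗ[ℂ] H) (M D : Submodule ℂ H) : Prop :=
  FiniteDimensional ℂ D ∧ M.map T ≤ M ⊔ D

/-- `M` is closed and has a defect space of dimension `p` for `T`. -/
def IsAlmostInvariantWith (T : H →ₗ[ℂ] H) (M : Submodule ℂ H) (p : ℕ) : Prop :=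
  IsClosed (M : Set H) ∧ ∃ D : Submodule ℂ H, IsDefectSpace T M D ∧ Module.finrank ℂ D = p

/-- `p` is the smallest possible dimension of a defect space of `M` for `T`. -/
def IsMinimalDefect (T : H →ₗ[ℂ] H) (M : Submodule ℂ H) (p : ℕ) : Prop :=
  IsLeast {d : ℕ | ∃ D : Submodule ℂ H, IsDefectSpace T M D ∧ Module.finrank ℂ D = d} p

/-- A closed subspace of infinite dimension and infinite codimension. -/
def IsHalfSpace (M : Submodule ℂ H) : Prop :=
  IsClosed (M : Set H) ∧ ¬ FiniteDimensional ℂ M ∧ ¬ FiniteDimensional ℂ (H ⧸ M)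

end AlmostInvariant

end HardyShift

namespace HardyShift

/-! ### The shift, constants and point evaluations -/

/-! Multiplication by an inner multiplier is an isometry commuting with S. Write Θ* for its adjoint
and M for (Ψ K_Θ)ᗮ. Then F lies in M iff Ψ*F is orthogonal to K_Θ, that is, iff Ψ*F ∈ ΘH²; splitting
F = ΨΨ*F + (F - ΨΨ*F) gives M = ΨΘH² ⊕ K_Ψ.

The first summand is S-invariant. For F ∈ K_Ψ, the function Ψ*SF is orthogonal to the range of S,
hence constant, so SF ∈ K_Ψ + Ψℂᵐ and Ψℂᵐ is a defect space of dimension m. If Ψv is constant, the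
constants Ψ*SF are all orthogonal to v; if Θv = u is constant, Ψu already lies in M. Either way a
dimension is saved. Otherwise the constants Ψ*SF fill ℂᵐ and stay independent modulo ΘH². Since Ψ*
maps M into ΘH², every defect space must supply all m dimensions (`le_finrank_of_isDefectSpace`).

For the half-space claim, the codimension of M is infinite once K_Θ is infinite-dimensional. If K_Θ
were finite-dimensional, a polynomial in the backward shift would annihilate it. By duality each θ_j
would satisfy θ_j g = q with polynomials g, q. The isometry property forces |g| = |q| on the circle,
so in lowest terms g is, up to a unimodular factor, the conjugate reciprocal of q, and θ_j is a
finite Blaschke product (`IsDiagonal.isRationalInner_of_finiteDimensional`). -/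

@[simp] theorem shift_zero_apply {m : ℕ} (F : H2 m) : shift m F 0 = 0 := rfl

@[simp] theorem shift_succ_apply {m : ℕ} (F : H2 m) (n : ℕ) : shift m F (n + 1) = F n := rfl

theorem inner_shift_shift {m : ℕ} (F G : H2 m) :
    inner ℂ (shift m F) (shift m G) = inner ℂ F G := by
  have h := lp.summable_inner (𝕜 := ℂ) (G := fun _ : ℕ => Cn m) (shift m F) (shift m G)
  rw [lp.inner_eq_tsum, lp.inner_eq_tsum, h.tsum_eq_zero_add]
  simp

/-- The shift as a linear isometry. -/
noncomputable def shiftIsometry (m : ℕ) : H2 m →ₗᵢ[ℂ] H2 m :=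
  (shift m).isometryOfInner inner_shift_shift

/-- The shift as a bounded operator. -/
noncomputable def shiftCLM (m : ℕ) : H2 m →L[ℂ] H2 m := (shiftIsometry m).toContinuousLinearMap

@[simp] theorem shiftCLM_apply {m : ℕ} (F : H2 m) : shiftCLM m F = shift m F := rfl

/-- The constant function with value `v`. -/
noncomputable def const (m : ℕ) : Cn m →ₗ[ℂ] H2 m :=
  lp.lsingle (𝕜 := ℂ) (E := fun _ : ℕ => Cn m) 2 0

theorem const_apply_zero {m : ℕ} (v : Cn m) : const m v 0 = v :=
  lp.single_apply_self (E := fun _ : ℕ => Cn m) 2 0 v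

theorem const_apply_of_ne {m : ℕ} (v : Cn m) {n : ℕ} (hn : n ≠ 0) : const m v n = 0 :=
  lp.single_apply_ne (E := fun _ : ℕ => Cn m) 2 0 v hn

theorem const_injective (m : ℕ) : Function.Injective (const m) := fun v w h => by
  rw [← const_apply_zero v, h, const_apply_zero]

theorem inner_const_const {m : ℕ} (v w : Cn m) :
    inner ℂ (const m v) (const m w) = inner ℂ v w := by
  rw [lp.inner_eq_tsum, tsum_eq_single 0, const_apply_zero, const_apply_zero]
  intro n hn
  rw [const_apply_of_ne v hn, inner_zero_left]

theorem inner_const_shift {m : ℕ} (v : Cn m) (F : H2 m) :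
    inner ℂ (const m v) (shift m F) = 0 := by
  rw [lp.inner_eq_tsum, tsum_eq_single 0]
  · simp
  · intro n hn
    rw [const_apply_of_ne v hn, inner_zero_left]

theorem eq_const_add_shift {m : ℕ} (F : H2 m) : ∃ G : H2 m, F = const m (F 0) + shift m G := by
  have hG : Memℓp (fun n => F (n + 1)) 2 := by
    refine (memℓp_gen_iff (p := 2) (by norm_num)).2 ?_
    exact (summable_nat_add_iff 1).2 ((memℓp_gen_iff (p := 2) (by norm_num)).1 (lp.memℓp F))
  refine ⟨⟨_, hG⟩, ?_⟩
  ext n : 2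
  rw [lp.coeFn_add, Pi.add_apply]
  cases n with
  | zero => rw [const_apply_zero, shift_zero_apply, add_zero]
  | succ n => rw [const_apply_of_ne _ n.succ_ne_zero, zero_add, shift_succ_apply]

/-- A function orthogonal to the range of the shift is constant. -/
theorem eq_const_of_inner_shift_eq_zero {m : ℕ} (F : H2 m)
    (h : ∀ G, inner ℂ (shift m G) F = 0) : F = const m (F 0) := by
  obtain ⟨G, hG⟩ := eq_const_add_shift F
  have h1 := h G
  rw [hG, inner_add_right, inner_shift_shift, ← inner_conj_symm, inner_const_shift, map_zero,
    zero_add, inner_self_eq_zero] at h1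
  rwa [h1, map_zero, add_zero] at hG

@[simp] theorem eval_const {m : ℕ} (v : Cn m) (z : ℂ) : eval (const m v) z = v := by
  rw [eval, tsum_eq_single 0, const_apply_zero, pow_zero, one_smul]
  intro n hn
  rw [const_apply_of_ne v hn, smul_zero]

theorem hasFPowerSeriesAt_eval {m : ℕ} (F : H2 m) :
    HasFPowerSeriesAt (eval F)
      (fun n => ContinuousMultilinearMap.mkPiRing ℂ (Fin n) (F n)) 0 := by
  refine hasFPowerSeriesAt_iff.2 ?_
  filter_upwards [ball_mem_nhds (0 : ℂ) one_pos] with z hz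
  simpa [FormalMultilinearSeries.coeff, eval] using (summable_eval F hz).hasSum

/-- A function in `H²` is determined by its values on the disc. -/
theorem eq_of_eval_eq {m : ℕ} {F G : H2 m}
    (h : ∀ z ∈ ball (0 : ℂ) 1, eval F z = eval G z) : F = G := by
  have h1 := (hasFPowerSeriesAt_eval F).eq_formalMultilinearSeries_of_eventually
    (hasFPowerSeriesAt_eval G) (by
      filter_upwards [ball_mem_nhds (0 : ℂ) one_pos] with z hz using h z hz)
  ext n : 2
  simpa using DFunLike.congr_fun (congrFun h1 n) fun _ => (1 : ℂ)

/-! ### Adjoints of inner multipliers and model spaces -/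

namespace InnerMultiplier

variable {r m : ℕ} (Θ : InnerMultiplier r m)

theorem mul_shift (F : H2 r) : Θ.mul (shift r F) = shift m (Θ.mul F) :=
  eq_of_eval_eq fun z hz => by
    rw [eval_mul _ _ hz, eval_shift _ hz, eval_shift _ hz, eval_mul _ _ hz, map_smul]

theorem isConstOnDisc_apply_iff (v : Cn r) :
    IsConstOnDisc (fun z => Θ.toFun z v) ↔ ∃ u, Θ.mul (const r v) = const m u := by
  refine exists_congr fun u => ⟨fun h => eq_of_eval_eq fun z hz => ?_, fun h z hz => ?_⟩
  · rw [eval_mul _ _ hz, eval_const, eval_const]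
    exact h z hz
  · simpa [eval_mul _ _ hz] using congrArg (eval · z) h

/-- The adjoint of the multiplication operator. -/
noncomputable def adj : H2 m →L[ℂ] H2 r :=
  ContinuousLinearMap.adjoint Θ.mul.toContinuousLinearMap

theorem inner_adj (F : H2 r) (G : H2 m) :
    inner ℂ F (Θ.adj G) = inner ℂ (Θ.mul F) G :=
  ContinuousLinearMap.adjoint_inner_right Θ.mul.toContinuousLinearMap F G

theorem adj_mul (F : H2 r) : Θ.adj (Θ.mul F) = F :=
  ext_inner_left ℂ fun G => by rw [inner_adj, LinearIsometry.inner_map_map]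

theorem mem_image_top {F : H2 m} : F ∈ Θ.image ⊤ ↔ ∃ G, Θ.mul G = F := by
  simp [image]

theorem mem_modelSpace {F : H2 m} : F ∈ Θ.modelSpace ↔ Θ.adj F = 0 := by
  rw [modelSpace, Submodule.mem_orthogonal]
  constructor
  · intro h
    refine ext_inner_left ℂ fun G => ?_
    rw [inner_adj, inner_zero_right]
    exact h _ (Θ.mem_image_top.2 ⟨G, rfl⟩)
  · intro h G hG
    obtain ⟨G, rfl⟩ := Θ.mem_image_top.1 hG
    rw [← inner_adj, h, inner_zero_right]

theorem sub_mem_modelSpace (F : H2 m) : F - Θ.mul (Θ.adj F) ∈ Θ.modelSpace := by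
  rw [mem_modelSpace, map_sub, adj_mul, sub_self]

/-- The range of an isometry is closed, so no closure appears: F - ΘΘ*F lies in the model space and
is orthogonal both to F and to ΘΘ*F, hence vanishes. -/
theorem modelSpace_orthogonal : Θ.modelSpaceᗮ = Θ.image ⊤ := by
  refine le_antisymm (fun F hF => ?_) (Submodule.le_orthogonal_orthogonal _)
  have h := hF _ (Θ.sub_mem_modelSpace F)
  have h2 : inner ℂ (F - Θ.mul (Θ.adj F)) (Θ.mul (Θ.adj F)) = 0 := by
    rw [← inner_conj_symm, ← inner_adj, Θ.mem_modelSpace.1 (Θ.sub_mem_modelSpace F),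
      inner_zero_right, map_zero]
  have h3 : inner ℂ (F - Θ.mul (Θ.adj F)) (F - Θ.mul (Θ.adj F)) = 0 := by
    rw [inner_sub_right, h, h2, sub_zero]
  exact Θ.mem_image_top.2 ⟨_, (sub_eq_zero.1 (inner_self_eq_zero.1 h3)).symm⟩

/-- A constant in the range of an inner multiplier is the image of a constant. -/
theorem eq_const_of_mul_eq_const {F : H2 r} {u : Cn m} (h : Θ.mul F = const m u) :
    F = const r (F 0) := by
  refine eq_const_of_inner_shift_eq_zero F fun G => ?_
  rw [← Θ.mul.inner_map_map, h, mul_shift, ← inner_conj_symm, inner_const_shift, map_zero]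

/-- The model space is mapped by the shift into itself plus the image of the constants. -/
theorem adj_shift_eq_const {F : H2 m} (hF : F ∈ Θ.modelSpace) :
    Θ.adj (shift m F) = const r (Θ.adj (shift m F) 0) := by
  refine eq_const_of_inner_shift_eq_zero _ fun G => ?_
  rw [inner_adj, mul_shift, inner_shift_shift, ← inner_adj, Θ.mem_modelSpace.1 hF,
    inner_zero_right]

/-- The backward shift of the image of a constant lies in the model space. -/
theorem adjoint_shift_mem_modelSpace (v : Cn r) :
    ContinuousLinearMap.adjoint (shiftCLM m) (Θ.mul (const r v)) ∈ Θ.modelSpace := by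
  rw [mem_modelSpace]
  refine ext_inner_left ℂ fun G => ?_
  rw [inner_adj, ContinuousLinearMap.adjoint_inner_right, shiftCLM_apply, ← mul_shift,
    Θ.mul.inner_map_map, inner_zero_right, ← inner_conj_symm, inner_const_shift, map_zero]

/-- A constant orthogonal to every `Θ* S f`, `f` in the model space, has constant image. -/
theorem mul_const_eq_const {v : Cn r}
    (h : ∀ F ∈ Θ.modelSpace, inner ℂ (shift m F) (Θ.mul (const r v)) = 0) :
    ∃ u, Θ.mul (const r v) = const m u := by
  have h0 := h _ (Θ.adjoint_shift_mem_modelSpace v)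
  -- The hypothesis at F = S*Θv reads ‖S*Θv‖² = 0, and the kernel of S* consists of the constants.
  rw [← shiftCLM_apply, ← ContinuousLinearMap.adjoint_inner_right, inner_self_eq_zero] at h0
  refine ⟨_, eq_const_of_inner_shift_eq_zero _ fun G => ?_⟩
  rw [← shiftCLM_apply, ← ContinuousLinearMap.adjoint_inner_right, h0, inner_zero_right]

/-! ### Diagonal multipliers -/

theorem IsDiagonal.apply {Θ : InnerMultiplier m m} {θ : Fin m → ℂ → ℂ} (hΘ : Θ.IsDiagonal θ)
    {z : ℂ} (hz : z ∈ ball (0 : ℂ) 1) (v : Cn m) (i : Fin m) :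
    Θ.toFun z v i = θ i z * v i := by
  rw [hΘ z hz, Matrix.ofLp_toEuclideanCLM, Matrix.mulVec_diagonal]

/-- Entry i acts on coordinate i alone: a constant Θv has a constant entry wherever v i ≠ 0, and a
constant entry is witnessed by a basis vector. This puts the condition on the entries in the
coordinate-free form used for the minimal defect. -/
theorem IsDiagonal.forall_not_isConstOnDisc_iff {Θ : InnerMultiplier m m} {θ : Fin m → ℂ → ℂ}
    (hΘ : Θ.IsDiagonal θ) :
    (∀ i, ¬ IsConstOnDisc (θ i)) ↔
      ∀ v : Cn m, v ≠ 0 → ¬ IsConstOnDisc (fun z => Θ.toFun z v) := by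
  constructor
  · rintro h v hv ⟨c, hc⟩
    obtain ⟨i, hi⟩ : ∃ i, v i ≠ 0 := by
      by_contra! h0
      exact hv (PiLp.ext h0)
    refine h i ⟨c i / v i, fun z hz => ?_⟩
    rw [eq_div_iff hi, ← hΘ.apply hz]
    exact congrArg (fun w : Cn m => w i) (hc z hz)
  · rintro h i ⟨c, hc⟩
    refine h (EuclideanSpace.single i 1) (by simp) ⟨EuclideanSpace.single i c, fun z hz => ?_⟩
    ext j
    rw [hΘ.apply hz]
    by_cases hj : j = i
    · subst hj; simp [hc z hz]
    · simp [hj]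

end InnerMultiplier
end HardyShift

namespace HardyShift
namespace InnerMultiplier

variable {r m : ℕ} (Ψ : InnerMultiplier m m) (Θ : InnerMultiplier r m)

/-! ### The orthogonal complement of `Ψ K_Θ` and its defect spaces -/

theorem orthogonal_image_modelSpace :
    (Ψ.image Θ.modelSpace)ᗮ = Ψ.image (Θ.image ⊤) ⊔ Ψ.modelSpace := by
  refine le_antisymm (fun F hF => ?_) (sup_le ?_ fun F hF => ?_)
  · have h : Ψ.adj F ∈ Θ.image ⊤ := by
      rw [← modelSpace_orthogonal, Submodule.mem_orthogonal]
      intro K hK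
      rw [inner_adj]
      exact hF _ (Submodule.mem_map_of_mem hK)
    rw [← add_sub_cancel (Ψ.mul (Ψ.adj F)) F]
    exact Submodule.add_mem_sup (Submodule.mem_map_of_mem h) (Ψ.sub_mem_modelSpace F)
  · rintro _ ⟨F, hF, rfl⟩
    rw [Submodule.mem_orthogonal]
    rintro _ ⟨K, hK, rfl⟩
    have h := Submodule.inner_left_of_mem_orthogonal hF hK
    simpa using h
  · rw [Submodule.mem_orthogonal]
    rintro _ ⟨K, -, rfl⟩
    change inner ℂ (Ψ.mul K) F = 0
    rw [← inner_adj, Ψ.mem_modelSpace.1 hF, inner_zero_right]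

theorem image_isOrtho_modelSpace (K : Submodule ℂ (H2 m)) : Ψ.image K ⟂ Ψ.modelSpace :=
  (Submodule.isOrtho_orthogonal_right (Ψ.image ⊤)).mono_left (Submodule.map_mono le_top)

/-- The functions `Ψ v` with `v` in a subspace `U` of `ℂᵐ`. -/
noncomputable def imageConst (U : Submodule ℂ (Cn m)) : Submodule ℂ (H2 m) :=
  U.map (Ψ.mul.toLinearMap ∘ₗ const m)

theorem finrank_imageConst (U : Submodule ℂ (Cn m)) :
    Module.finrank ℂ (Ψ.imageConst U) = Module.finrank ℂ U :=
  have h : Function.Injective (Ψ.mul.toLinearMap ∘ₗ const m) :=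
    Ψ.mul.injective.comp (const_injective m)
  (Submodule.equivMapOfInjective _ h U).finrank_eq.symm

/-- `Ψ U` is a defect space of `(Ψ K_Θ)ᗮ` as soon as it absorbs the components of `S K_Ψ`. -/
theorem isDefectSpace_imageConst (U : Submodule ℂ (Cn m))
    (hU : ∀ F ∈ Ψ.modelSpace,
      Ψ.mul (const m (Ψ.adj (shift m F) 0)) ∈ (Ψ.image Θ.modelSpace)ᗮ ⊔ Ψ.imageConst U) :
    IsDefectSpace (shift m) (Ψ.image Θ.modelSpace)ᗮ (Ψ.imageConst U) := by
  refine ⟨by unfold imageConst; infer_instance, ?_⟩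
  rintro _ ⟨F, hF, rfl⟩
  have hM := Ψ.orthogonal_image_modelSpace Θ
  have h1 : Ψ.image (Θ.image ⊤) ≤ (Ψ.image Θ.modelSpace)ᗮ := hM ▸ le_sup_left
  have h2 : Ψ.modelSpace ≤ (Ψ.image Θ.modelSpace)ᗮ := hM ▸ le_sup_right
  rw [SetLike.mem_coe, hM, Submodule.mem_sup] at hF
  obtain ⟨_, ⟨G, hG, rfl⟩, K, hK, rfl⟩ := hF
  obtain ⟨G, rfl⟩ := Θ.mem_image_top.1 hG
  rw [map_add]
  refine add_mem (Submodule.mem_sup_left (h1 ?_)) ?_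
  · change shift m (Ψ.mul (Θ.mul G)) ∈ _
    rw [← mul_shift, ← mul_shift]
    exact Submodule.mem_map_of_mem (Θ.mem_image_top.2 ⟨_, rfl⟩)
  · have h3 := hU K hK
    rw [← Ψ.adj_shift_eq_const hK] at h3
    rw [← sub_add_cancel (shift m K) (Ψ.mul (Ψ.adj (shift m K)))]
    exact add_mem (Submodule.mem_sup_left (h2 (Ψ.sub_mem_modelSpace _))) h3

theorem isDefectSpace_imageConst_top :
    IsDefectSpace (shift m) (Ψ.image Θ.modelSpace)ᗮ (Ψ.imageConst ⊤) :=
  Ψ.isDefectSpace_imageConst Θ ⊤ fun _ _ =>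
    Submodule.mem_sup_right (Submodule.mem_map_of_mem (f := Ψ.mul.toLinearMap ∘ₗ const m) trivial)

theorem finrank_imageConst_top : Module.finrank ℂ (Ψ.imageConst ⊤) = m := by
  rw [finrank_imageConst, finrank_top, finrank_euclideanSpace_fin]

theorem isAlmostInvariantWith :
    IsAlmostInvariantWith (shift m) (Ψ.image Θ.modelSpace)ᗮ m :=
  ⟨Submodule.isClosed_orthogonal _, _, Ψ.isDefectSpace_imageConst_top Θ,
    Ψ.finrank_imageConst_top⟩

/-- If the defect `m` is minimal, `Ψ` maps no orthocomplement of a line of constants onto a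
defect space. -/
theorem IsMinimalDefect.not_isDefectSpace_orthogonal
    (h : IsMinimalDefect (shift m) (Ψ.image Θ.modelSpace)ᗮ m) {u : Cn m} (hu : u ≠ 0) :
    ¬ IsDefectSpace (shift m) (Ψ.image Θ.modelSpace)ᗮ (Ψ.imageConst (ℂ ∙ u)ᗮ) := fun hD => by
  have h1 := h.2 ⟨_, hD, rfl⟩
  rw [finrank_imageConst] at h1
  have h2 := Submodule.finrank_add_finrank_orthogonal (ℂ ∙ u)
  rw [finrank_span_singleton hu, finrank_euclideanSpace_fin] at h2
  omega

/-- Lower bound for the dimension of a defect space. -/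
theorem le_finrank_of_isDefectSpace
    (hΨ : ∀ v : Cn m, v ≠ 0 → ¬ IsConstOnDisc (fun z => Ψ.toFun z v))
    (hΘ : ∀ v : Cn r, v ≠ 0 → ¬ IsConstOnDisc (fun z => Θ.toFun z v))
    {D : Submodule ℂ (H2 m)}
    (hD : IsDefectSpace (shift m) (Ψ.image Θ.modelSpace)ᗮ D) : m ≤ Module.finrank ℂ D := by
  have := hD.1
  let W : Submodule ℂ (Cn m) := (Ψ.modelSpace.map (Ψ.adj.toLinearMap ∘ₗ shift m)).comap (const m)
  -- W consists of the constants Ψ*SF with F ∈ K_Ψ. If v is orthogonal to W, then Ψv is orthogonal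
  -- to S K_Ψ, which forces Ψv to be constant.
  have hW : W = ⊤ := by
    rw [← Submodule.orthogonal_eq_bot_iff, Submodule.eq_bot_iff]
    intro v hv
    by_contra hv0
    refine hΨ v hv0 ((Ψ.isConstOnDisc_apply_iff v).2 (Ψ.mul_const_eq_const fun F hF => ?_))
    have h1 : Ψ.adj (shift m F) 0 ∈ W :=
      ⟨F, hF, Ψ.adj_shift_eq_const hF⟩
    have h2 := hv _ h1
    rw [← inner_const_const, ← Ψ.adj_shift_eq_const hF, ← inner_conj_symm, inner_adj,
      inner_conj_symm] at h2
    exact h2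
  -- Ψ* followed by reduction modulo ΘH² kills (Ψ K_Θ)ᗮ, so on shifted elements it only sees their
  -- component in D.
  let A : H2 m →ₗ[ℂ] H2 m ⧸ Θ.image ⊤ := (Θ.image ⊤).mkQ ∘ₗ Ψ.adj.toLinearMap
  have hA : ∀ F ∈ (Ψ.image Θ.modelSpace)ᗮ, A F = 0 := by
    intro F hF
    rw [orthogonal_image_modelSpace, Submodule.mem_sup] at hF
    obtain ⟨_, ⟨G, hG, rfl⟩, K, hK, rfl⟩ := hF
    change (Θ.image ⊤).mkQ (Ψ.adj (Ψ.mul G + K)) = 0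
    rw [map_add, adj_mul, Ψ.mem_modelSpace.1 hK, add_zero]
    exact (Submodule.Quotient.mk_eq_zero _).2 hG
  let B : Cn m →ₗ[ℂ] H2 m ⧸ Θ.image ⊤ := (Θ.image ⊤).mkQ ∘ₗ const m
  -- A constant in ΘH² is the image of a constant, which the hypothesis on Θ excludes unless it is
  -- zero.
  have hB : Function.Injective B := by
    rw [← LinearMap.ker_eq_bot, LinearMap.ker_eq_bot']
    intro u hu
    obtain ⟨G, hG⟩ := Θ.mem_image_top.1 ((Submodule.Quotient.mk_eq_zero _).1 hu)
    by_contra hu0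
    have hG' := Θ.eq_const_of_mul_eq_const hG
    refine hΘ (G 0) (fun h0 => hu0 ?_)
      ((Θ.isConstOnDisc_apply_iff _).2 ⟨u, by rw [← hG', hG]⟩)
    rw [h0, map_zero] at hG'
    rw [hG', map_zero] at hG
    exact const_injective m (by rw [← hG, map_zero])
  have hBA : LinearMap.range B ≤ D.map A := by
    rintro _ ⟨v, rfl⟩
    obtain ⟨F, hF, hFv⟩ : v ∈ W := hW ▸ Submodule.mem_top
    have hFM : F ∈ (Ψ.image Θ.modelSpace)ᗮ := by
      rw [orthogonal_image_modelSpace]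
      exact Submodule.mem_sup_right hF
    obtain ⟨G, hG, K, hK, hGK⟩ := Submodule.mem_sup.1 (hD.2 (Submodule.mem_map_of_mem hFM))
    refine ⟨K, hK, ?_⟩
    have h1 : A K = A (shift m F) := by rw [← hGK, map_add, hA G hG, zero_add]
    rw [h1]
    exact congrArg (Θ.image ⊤).mkQ hFv
  calc m = Module.finrank ℂ (LinearMap.range B) := by
        rw [LinearMap.finrank_range_of_inj hB, finrank_euclideanSpace_fin]
    _ ≤ Module.finrank ℂ (D.map A) := Submodule.finrank_mono hBA
    _ ≤ Module.finrank ℂ D := Submodule.finrank_map_le A D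

theorem isMinimalDefect_iff :
    IsMinimalDefect (shift m) (Ψ.image Θ.modelSpace)ᗮ m ↔
      (∀ v : Cn m, v ≠ 0 → ¬ IsConstOnDisc (fun z => Ψ.toFun z v)) ∧
      ∀ v : Cn r, v ≠ 0 → ¬ IsConstOnDisc (fun z => Θ.toFun z v) := by
  refine ⟨fun h => ⟨fun v hv hc => ?_, fun v hv hc => ?_⟩, fun h =>
    ⟨⟨_, Ψ.isDefectSpace_imageConst_top Θ, Ψ.finrank_imageConst_top⟩, ?_⟩⟩
  · obtain ⟨u, hu⟩ := (Ψ.isConstOnDisc_apply_iff v).1 hc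
    refine IsMinimalDefect.not_isDefectSpace_orthogonal Ψ Θ h hv
      (Ψ.isDefectSpace_imageConst Θ _ fun F hF => Submodule.mem_sup_right
        (Submodule.mem_map_of_mem (f := Ψ.mul.toLinearMap ∘ₗ const m) ?_))
    -- ⟨v, Ψ*SF⟩ = ⟨Ψv, SF⟩ = ⟨u, SF⟩ = 0, since constants are orthogonal to the range of S.
    rw [Submodule.mem_orthogonal_singleton_iff_inner_right, ← inner_const_const,
      ← Ψ.adj_shift_eq_const hF, inner_adj, hu, inner_const_shift]
  · obtain ⟨u, hu⟩ := (Θ.isConstOnDisc_apply_iff v).1 hc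
    have hu0 : u ≠ 0 := by
      rintro rfl
      rw [map_zero, map_eq_zero_iff _ Θ.mul.injective,
        map_eq_zero_iff _ (const_injective r)] at hu
      exact hv hu
    refine IsMinimalDefect.not_isDefectSpace_orthogonal Ψ Θ h hu0
      (Ψ.isDefectSpace_imageConst Θ _ fun F hF => ?_)
    -- Split the constant Ψ*SF along u: the u-component contributes a multiple of Ψu = ΨΘv, already
    -- in (Ψ K_Θ)ᗮ.
    obtain ⟨a, ha, b, hb, hab⟩ := Submodule.mem_sup.1 (show Ψ.adj (shift m F) 0 ∈
      (ℂ ∙ u) ⊔ (ℂ ∙ u)ᗮ by rw [Submodule.sup_orthogonal_of_hasOrthogonalProjection]; trivial)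
    rw [← hab, map_add, map_add]
    refine Submodule.add_mem_sup ?_
      (Submodule.mem_map_of_mem (f := Ψ.mul.toLinearMap ∘ₗ const m) hb)
    obtain ⟨c, rfl⟩ := Submodule.mem_span_singleton.1 ha
    rw [orthogonal_image_modelSpace]
    refine Submodule.mem_sup_left (Submodule.mem_map_of_mem (Θ.mem_image_top.2
      ⟨const r (c • v), ?_⟩))
    rw [map_smul, map_smul, hu, map_smul]
  · rintro _ ⟨D, hD, rfl⟩
    exact Ψ.le_finrank_of_isDefectSpace Θ h.1 h.2 hD

end InnerMultiplier
end HardyShift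

namespace HardyShift

/-! ### Polynomials with the same modulus on the circle -/

section Polynomial

open Polynomial

theorem map_conj_map_conj (p : ℂ[X]) : (p.map (starRingEnd ℂ)).map (starRingEnd ℂ) = p := by
  ext n
  simp

theorem natDegree_map_conj (p : ℂ[X]) : (p.map (starRingEnd ℂ)).natDegree = p.natDegree :=
  natDegree_map_eq_of_injective (starRingEnd ℂ).injective p

theorem map_conj_ne_zero {p : ℂ[X]} (hp : p ≠ 0) : p.map (starRingEnd ℂ) ≠ 0 :=
  (Polynomial.map_ne_zero_iff (starRingEnd ℂ).injective).2 hp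

/-- If `|g| = |q|` on the circle and `g` is coprime to `q`, then `g` is a unimodular multiple of
the reciprocal polynomial of `q`. -/
theorem eq_C_mul_reverse_of_mul_reflect_eq {g q : ℂ[X]} (hq : q ≠ 0) (hgq : IsCoprime q g)
    (hdeg : g.natDegree ≤ q.natDegree)
    (h : g * (g.map (starRingEnd ℂ)).reflect q.natDegree =
      q * (q.map (starRingEnd ℂ)).reflect q.natDegree) :
    ∃ c : ℂ, ‖c‖ = 1 ∧ g = C c * (q.map (starRingEnd ℂ)).reverse := by
  have hrev : (q.map (starRingEnd ℂ)).reverse = (q.map (starRingEnd ℂ)).reflect q.natDegree := by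
    rw [reverse, natDegree_map_conj]
  have hrev0 : (q.map (starRingEnd ℂ)).reverse ≠ 0 := by
    rw [Ne, reverse_eq_zero]
    exact map_conj_ne_zero hq
  rw [hrev] at hrev0 ⊢
  obtain ⟨k, hk⟩ := hgq.dvd_of_dvd_mul_left ⟨_, h⟩
  have hk0 : k ≠ 0 := by
    rintro rfl
    rw [mul_zero] at hk
    rw [hk, mul_zero] at h
    exact mul_ne_zero hq hrev0 h.symm
  -- The reflected polynomial has degree at most that of q, so its cofactor k is a constant.
  have hkd : k.natDegree = 0 := by
    have h1 : ((g.map (starRingEnd ℂ)).reflect q.natDegree).natDegree ≤ q.natDegree := by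
      refine natDegree_reflect_le.trans ?_
      rw [natDegree_map_conj]
      exact max_le le_rfl hdeg
    rw [hk, natDegree_mul hq hk0] at h1
    omega
  rw [natDegree_eq_zero] at hkd
  obtain ⟨a, rfl⟩ := hkd
  have hg : g = C (conj a) * (q.map (starRingEnd ℂ)).reflect q.natDegree := by
    have h1 := congrArg (fun p => (p.reflect q.natDegree).map (starRingEnd ℂ)) hk
    simp only [reflect_reflect, map_conj_map_conj] at h1
    rw [h1, mul_comm q, reflect_C_mul, Polynomial.map_mul, map_C, reflect_map]
  refine ⟨conj a, ?_, hg⟩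
  -- Substituting both expressions back into the modulus identity leaves the factor |a|², which must
  -- be 1.
  have h2 : C (conj a * a) * (q * (q.map (starRingEnd ℂ)).reflect q.natDegree) =
      1 * (q * (q.map (starRingEnd ℂ)).reflect q.natDegree) := by
    rw [hk] at h
    conv_rhs => rw [one_mul, ← h, hg]
    rw [C_mul]
    ring
  have h3 := mul_right_cancel₀ (mul_ne_zero hq hrev0) h2
  rw [← C_1, C_inj, Complex.conj_mul'] at h3
  rw [RCLike.norm_conj]
  have h4 : ‖a‖ ^ 2 = 1 := by exact_mod_cast h3
  exact (pow_eq_one_iff_of_nonneg (norm_nonneg a) two_ne_zero).1 h4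

/-- Reversal is multiplicative and turns X - conj a into 1 - conj a X, so the zeros of q produce the
denominators of the Blaschke factors. -/
theorem reverse_map_conj_prod (s : Multiset ℂ) :
    (((s.map fun a => X - C a).prod).map (starRingEnd ℂ)).reverse =
      (s.map fun a => 1 - C (conj a) * X).prod := by
  induction s using Multiset.induction_on with
  | empty => simp [reverse]
  | cons a s ih =>
    rw [Multiset.map_cons, Multiset.prod_cons, Polynomial.map_mul, reverse_mul_of_domain, ih,
      Multiset.map_cons, Multiset.prod_cons]
    congr 1
    rw [Polynomial.map_sub, map_X, map_C, reverse, natDegree_X_sub_C, reflect_sub,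
      reflect_one_X, reflect_C, pow_one]

theorem isRationalInner_of_mul_eval_eq {θ : ℂ → ℂ} {g q : ℂ[X]} (hq : q ≠ 0)
    (hroots : ∀ a, q.IsRoot a → a ∈ ball (0 : ℂ) 1) (hgq : IsCoprime q g)
    (hdeg : g.natDegree ≤ q.natDegree)
    (h : g * (g.map (starRingEnd ℂ)).reflect q.natDegree =
      q * (q.map (starRingEnd ℂ)).reflect q.natDegree)
    (hθ : ∀ z ∈ ball (0 : ℂ) 1, θ z * g.eval z = q.eval z) : IsRationalInner θ := by
  obtain ⟨c, hc, hg⟩ := eq_C_mul_reverse_of_mul_reflect_eq hq hgq hdeg h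
  have hprod := (IsAlgClosed.splits q).eq_prod_roots
  have hl : q.leadingCoeff ≠ 0 := leadingCoeff_ne_zero.2 hq
  have hc0 : c ≠ 0 := norm_ne_zero_iff.1 (by rw [hc]; exact one_ne_zero)
  -- With l the leading coefficient, q = l ∏(X - a) and g = c (conj l) ∏(1 - conj a X); the quotient
  -- of the prefactors is unimodular.
  refine ⟨q.leadingCoeff / (c * conj q.leadingCoeff), q.roots, ?_,
    fun a ha => hroots a (isRoot_of_mem_roots ha), fun z hz => ?_⟩
  · rw [norm_div, norm_mul, hc, RCLike.norm_conj, one_mul, div_self (norm_ne_zero_iff.2 hl)]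
  · have h1 := hθ z hz
    have hne : (q.roots.map fun a => 1 - conj a * z).prod ≠ 0 := by
      rw [Ne, Multiset.prod_eq_zero_iff, Multiset.mem_map]
      rintro ⟨a, ha, h0⟩
      have ha1 : ‖a‖ < 1 := by simpa using hroots a (isRoot_of_mem_roots ha)
      have hz1 : ‖z‖ < 1 := by simpa using hz
      have h2 : ‖conj a * z‖ = 1 := by rw [← sub_eq_zero.1 h0, norm_one]
      rw [norm_mul, RCLike.norm_conj] at h2
      nlinarith [norm_nonneg a, norm_nonneg z]
    have hqz : q.eval z = q.leadingCoeff * (q.roots.map fun a => z - a).prod := by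
      conv_lhs => rw [hprod]
      rw [eval_mul, eval_C, eval_multiset_prod, Multiset.map_map]
      simp
    have hgz : g.eval z =
        c * (conj q.leadingCoeff * (q.roots.map fun a => 1 - conj a * z).prod) := by
      have h3 : (q.map (starRingEnd ℂ)).reverse =
          C (conj q.leadingCoeff) * (q.roots.map fun a => 1 - C (conj a) * X).prod := by
        conv_lhs => rw [hprod]
        rw [Polynomial.map_mul, map_C, reverse_mul_of_domain, reverse_C, reverse_map_conj_prod]
      rw [hg, h3, eval_mul, eval_C, eval_mul, eval_C, eval_multiset_prod, Multiset.map_map]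
      simp
    rw [hqz, hgz] at h1
    have hl' : conj q.leadingCoeff ≠ 0 := (_root_.map_ne_zero _).2 hl
    rw [Multiset.prod_map_div, div_mul_div_comm, eq_div_iff
      (mul_ne_zero (mul_ne_zero hc0 hl') hne), ← h1]
    ring

end Polynomial
end HardyShift

namespace HardyShift

/-! ### Polynomials in the shift -/

section PolynomialShift

open Polynomial

variable {m : ℕ}

theorem shift_pow_apply_of_lt (F : H2 m) {n k : ℕ} (h : k < n) : (shift m ^ n) F k = 0 := by
  induction n generalizing k with
  | zero => omega
  | succ n ih =>
    rw [pow_succ', Module.End.mul_apply]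
    cases k with
    | zero => exact shift_zero_apply _
    | succ k => rw [shift_succ_apply, ih (by omega)]

theorem shift_pow_const_apply (v : Cn m) (n k : ℕ) :
    (shift m ^ n) (const m v) k = if k = n then v else 0 := by
  induction n generalizing k with
  | zero =>
    by_cases hk : k = 0
    · subst hk; simp [const_apply_zero]
    · simp [const_apply_of_ne v hk, hk]
  | succ n ih =>
    rw [pow_succ', Module.End.mul_apply]
    cases k with
    | zero => simp
    | succ k => rw [shift_succ_apply, ih]; simp

theorem inner_shift_pow_const (v : Cn m) (n : ℕ) (F : H2 m) :
    inner ℂ ((shift m ^ n) (const m v)) F = inner ℂ v (F n) := by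
  rw [lp.inner_eq_tsum, tsum_eq_single n, shift_pow_const_apply, if_pos rfl]
  intro k hk
  rw [shift_pow_const_apply, if_neg hk, inner_zero_left]

theorem aeval_shift_const_apply (p : ℂ[X]) (v : Cn m) (n : ℕ) :
    aeval (shift m) p (const m v) n = p.coeff n • v := by
  induction p using Polynomial.induction_on' with
  | add p q hp hq =>
    rw [map_add, LinearMap.add_apply, lp.coeFn_add, Pi.add_apply, hp, hq, coeff_add, add_smul]
  | monomial k a =>
    rw [aeval_monomial, Module.End.mul_apply, Module.algebraMap_end_apply, lp.coeFn_smul,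
      Pi.smul_apply, shift_pow_const_apply, coeff_monomial]
    by_cases h : n = k
    · simp [h]
    · simp [h, Ne.symm h]

theorem eval_aeval_shift (p : ℂ[X]) (F : H2 m) {z : ℂ} (hz : z ∈ ball (0 : ℂ) 1) :
    eval (aeval (shift m) p F) z = p.eval z • eval F z := by
  have hadd : ∀ F G : H2 m, eval (F + G) z = eval F z + eval G z := fun F G => by
    simp only [eval, lp.coeFn_add, Pi.add_apply, smul_add]
    exact (summable_eval F hz).tsum_add (summable_eval G hz)
  have hsmul : ∀ (a : ℂ) (F : H2 m), eval (a • F) z = a • eval F z := fun a F => by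
    simp only [eval, lp.coeFn_smul, Pi.smul_apply, smul_comm _ a]
    exact (summable_eval F hz).tsum_const_smul a
  induction p using Polynomial.induction_on generalizing F with
  | C a => rw [aeval_C, Module.algebraMap_end_apply, hsmul, eval_C]
  | add p q hp hq => rw [map_add, LinearMap.add_apply, hadd, hp, hq, eval_add, add_smul]
  | monomial n a ih =>
    rw [pow_succ, ← mul_assoc, map_mul, aeval_X, Module.End.mul_apply, ih, eval_shift F hz,
      eval_mul_X, smul_smul]

theorem coeff_aeval_shift (p : ℂ[X]) (F : H2 m) (i : Fin m) :
    PowerSeries.mk (fun n => aeval (shift m) p F n i) =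
      (p : PowerSeries ℂ) * PowerSeries.mk (fun n => F n i) := by
  induction p using Polynomial.induction_on generalizing F with
  | C a =>
    ext n
    simp [Module.algebraMap_end_apply]
  | add p q hp hq =>
    rw [Polynomial.coe_add, add_mul, ← hp, ← hq]
    ext n
    simp
  | monomial n a ih =>
    rw [pow_succ, ← mul_assoc, map_mul, aeval_X, Module.End.mul_apply, ih,
      Polynomial.coe_mul (C a * X ^ n) X, mul_assoc, Polynomial.coe_X]
    congr 1
    ext k
    cases k with
    | zero => simp
    | succ k => simp [PowerSeries.coeff_succ_X_mul]

/-- Coordinatewise, p(S) is multiplication by p in the domain of formal power series. -/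
theorem aeval_shift_injective {p : ℂ[X]} (hp : p ≠ 0) :
    Function.Injective (aeval (shift m) p) := by
  rw [← LinearMap.ker_eq_bot, LinearMap.ker_eq_bot']
  intro F hF
  ext n i
  have h := coeff_aeval_shift p F i
  rw [hF] at h
  have h0 : PowerSeries.mk (fun n => (0 : H2 m) n i) = 0 := by ext; simp
  rw [h0, eq_comm, mul_eq_zero, Polynomial.coe_eq_zero_iff] at h
  have h1 := congrArg (PowerSeries.coeff n) (h.resolve_left hp)
  simpa using h1

/-- Both sides sum a_i conj(b_l) over i + d = n + l. The left side encodes a · conj b on the circle,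
up to the factor z^d; the right side is preserved by any isometry commuting with S. -/
theorem coeff_mul_reflect_eq_inner {v : Cn m} (hv : ‖v‖ = 1) (a : ℂ[X]) {b : ℂ[X]} {d : ℕ}
    (hb : b.natDegree ≤ d) (n : ℕ) :
    (a * (b.map (starRingEnd ℂ)).reflect d).coeff n =
      inner ℂ (aeval (shift m) (X ^ n * b) (const m v))
        (aeval (shift m) (X ^ d * a) (const m v)) := by
  refine induction_with_natDegree_le (fun b => (a * (b.map (starRingEnd ℂ)).reflect d).coeff n =
    inner ℂ (aeval (shift m) (X ^ n * b) (const m v))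
      (aeval (shift m) (X ^ d * a) (const m v))) d (by simp) (fun l β _ hl => ?_)
    (fun f g _ _ hf hg => ?_) b hb
  · induction a using Polynomial.induction_on' with
    | add p q hp hq =>
      rw [add_mul, coeff_add, hp, hq, mul_add, map_add, LinearMap.add_apply, inner_add_right]
    | monomial i α =>
      have h1 : (X ^ n * (C β * X ^ l) : ℂ[X]) = C β * X ^ (n + l) := by ring
      have h2 : X ^ d * monomial i α = C α * X ^ (d + i) := by
        rw [← C_mul_X_pow_eq_monomial]; ring
      have h3 : monomial i α * (C (conj β) * X ^ (d - l)) =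
          C (α * conj β) * X ^ (i + (d - l)) := by
        rw [← C_mul_X_pow_eq_monomial, C_mul]; ring
      rw [Polynomial.map_mul, map_C, Polynomial.map_pow, map_X, reflect_C_mul_X_pow,
        revAt_le hl, h1, h2, h3, coeff_C_mul_X_pow, map_mul, map_mul, aeval_C, aeval_C, map_pow,
        map_pow, aeval_X, Module.End.mul_apply, Module.End.mul_apply,
        Module.algebraMap_end_apply, Module.algebraMap_end_apply, inner_smul_left,
        inner_smul_right, inner_shift_pow_const, shift_pow_const_apply]
      by_cases h : n = i + (d - l)
      · rw [if_pos h, if_pos (by omega), inner_self_eq_norm_sq_to_K, hv]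
        simp [mul_comm]
      · rw [if_neg h, if_neg (by omega)]
        simp
  · rw [Polynomial.map_add, reflect_add, mul_add, coeff_add, hf, hg, mul_add, map_add, LinearMap.add_apply, inner_add_left]

/-- The backward shift. -/
noncomputable def backwardShift (m : ℕ) : H2 m →ₗ[ℂ] H2 m :=
  (ContinuousLinearMap.adjoint (shiftCLM m)).toLinearMap

theorem inner_backwardShift (F G : H2 m) :
    inner ℂ F (backwardShift m G) = inner ℂ (shift m F) G :=
  ContinuousLinearMap.adjoint_inner_right (shiftCLM m) F G

theorem backwardShift_const_add_shift (v : Cn m) (F : H2 m) :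
    backwardShift m (const m v + shift m F) = F :=
  ext_inner_left ℂ fun G => by
    rw [inner_backwardShift, inner_add_right, inner_shift_shift, ← inner_conj_symm,
      inner_const_shift, map_zero, zero_add]

theorem inner_aeval_shift (p : ℂ[X]) (F G : H2 m) :
    inner ℂ (aeval (shift m) p F) G =
      inner ℂ F (aeval (backwardShift m) (p.map (starRingEnd ℂ)) G) := by
  induction p using Polynomial.induction_on generalizing F with
  | C a =>
    rw [map_C, aeval_C, aeval_C, Module.algebraMap_end_apply, Module.algebraMap_end_apply,
      inner_smul_left, inner_smul_right]
  | add p q hp hq =>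
    rw [map_add, LinearMap.add_apply, inner_add_left, hp, hq, Polynomial.map_add, map_add,
      LinearMap.add_apply, inner_add_right]
  | monomial n a ih =>
    rw [pow_succ, ← mul_assoc, map_mul, aeval_X, Module.End.mul_apply, ih, Polynomial.map_mul _ (q := X),
      mul_comm _ (X.map (starRingEnd ℂ)), map_mul, map_X, aeval_X, Module.End.mul_apply, inner_backwardShift]

/-- The eigenvalues of the backward shift lie in the open disc. -/
theorem norm_lt_one_of_backwardShift_eq_smul {F : H2 m} (hF : F ≠ 0) {c : ℂ}
    (h : backwardShift m F = c • F) : ‖c‖ < 1 := by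
  obtain ⟨G, hG⟩ := eq_const_add_shift F
  have h1 : G = c • F := by
    rw [← h]
    conv_rhs => rw [hG]
    rw [backwardShift_const_add_shift]
  by_contra! hc
  -- As G = cF, this reads ‖F‖² = ‖F 0‖² + |c|²‖F‖². If |c| ≥ 1 then F 0 = 0, and F = S(cF) makes
  -- all coefficients vanish in turn.
  have h2 : ‖F‖ ^ 2 = ‖F 0‖ ^ 2 + ‖G‖ ^ 2 := by
    have h3 : ‖const m (F 0)‖ = ‖F 0‖ := lp.norm_single (E := fun _ : ℕ => Cn m) (by norm_num) 0 _
    have h4 : ‖shift m G‖ = ‖G‖ := (shiftIsometry m).norm_map G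
    conv_lhs => rw [hG]
    rw [norm_add_sq (𝕜 := ℂ), inner_const_shift, h3, h4]
    simp
  have h5 : F 0 = 0 := by
    rw [h1, norm_smul, mul_pow] at h2
    have h6 : 1 ≤ ‖c‖ ^ 2 := one_le_pow₀ hc
    have h7 : ‖F 0‖ ^ 2 ≤ 0 := by nlinarith [sq_nonneg ‖F‖]
    exact norm_eq_zero.1 (pow_eq_zero_iff two_ne_zero |>.1 (le_antisymm h7 (sq_nonneg _)))
  refine hF (lp.ext (funext fun n => ?_))
  induction n with
  | zero => exact h5
  | succ n ih =>
    rw [hG, h5, map_zero, zero_add, shift_succ_apply, h1, lp.coeFn_smul, Pi.smul_apply, ih]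
    exact smul_zero c

theorem aeval_restrict_apply {H : Type*} [AddCommGroup H] [Module ℂ H] (T : H →ₗ[ℂ] H)
    {K : Submodule ℂ H} (hT : ∀ x ∈ K, T x ∈ K) (p : ℂ[X]) (x : K) :
    ((aeval (T.restrict hT) p x : K) : H) = aeval T p x := by
  induction p using Polynomial.induction_on generalizing x with
  | C a => simp [Module.algebraMap_end_apply]
  | add p q hp hq => simp [hp, hq]
  | monomial n a ih =>
    rw [pow_succ, ← mul_assoc, map_mul, aeval_X, Module.End.mul_apply, ih,
      map_mul (aeval T) _ X, aeval_X,
      Module.End.mul_apply, LinearMap.coe_restrict_apply]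

/-- A finite-dimensional subspace invariant under the backward shift is killed by a polynomial
with all its roots in the disc. -/
theorem exists_aeval_backwardShift_eq_zero {K : Submodule ℂ (H2 m)} [FiniteDimensional ℂ K]
    (hK : ∀ F ∈ K, backwardShift m F ∈ K) :
    ∃ p : ℂ[X], p ≠ 0 ∧ (∀ a, p.IsRoot a → a ∈ ball (0 : ℂ) 1) ∧
      ∀ F ∈ K, aeval (backwardShift m) p F = 0 := by
  let T := (backwardShift m).restrict hK
  -- The roots of the minimal polynomial are eigenvalues of the backward shift.
  refine ⟨minpoly ℂ T, minpoly.ne_zero (Algebra.IsIntegral.isIntegral T), fun a ha => ?_,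
    fun F hF => ?_⟩
  · obtain ⟨F, hF⟩ := (Module.End.hasEigenvalue_of_isRoot ha).exists_hasEigenvector
    have h1 : backwardShift m F = a • (F : H2 m) := congrArg Subtype.val hF.apply_eq_smul
    simpa using norm_lt_one_of_backwardShift_eq_smul (by simpa using hF.2) h1
  · have h := aeval_restrict_apply (backwardShift m) hK (minpoly ℂ T) ⟨F, hF⟩
    rw [show (backwardShift m).restrict hK = T from rfl, minpoly.aeval] at h
    exact h.symm

end PolynomialShift
end HardyShift

namespace HardyShift
namespace InnerMultiplier

/-! ### Finite-dimensional model spaces -/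

open Polynomial

variable {m : ℕ} {Θ : InnerMultiplier m m} {θ : Fin m → ℂ → ℂ}

theorem mul_aeval_shift (Θ : InnerMultiplier m m) (p : ℂ[X]) (F : H2 m) :
    Θ.mul (aeval (shift m) p F) = aeval (shift m) p (Θ.mul F) :=
  eq_of_eval_eq fun z hz => by
    rw [eval_mul _ _ hz, eval_aeval_shift _ _ hz, eval_aeval_shift _ _ hz, eval_mul _ _ hz,
      map_smul]

theorem backwardShift_mem_modelSpace (Θ : InnerMultiplier m m) {F : H2 m}
    (hF : F ∈ Θ.modelSpace) : backwardShift m F ∈ Θ.modelSpace := by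
  rw [mem_modelSpace]
  refine ext_inner_left ℂ fun G => ?_
  rw [inner_adj, inner_backwardShift, ← mul_shift, ← inner_adj, Θ.mem_modelSpace.1 hF,
    inner_zero_right, inner_zero_right]

theorem IsDiagonal.mul_aeval_shift_single_eq (hΘ : Θ.IsDiagonal θ) {g q : ℂ[X]} {j : Fin m}
    (h : ∀ z ∈ ball (0 : ℂ) 1, θ j z * g.eval z = q.eval z) :
    Θ.mul (aeval (shift m) g (const m (EuclideanSpace.single j 1))) =
      aeval (shift m) q (const m (EuclideanSpace.single j 1)) :=
  eq_of_eval_eq fun z hz => by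
    rw [eval_mul _ _ hz, eval_aeval_shift _ _ hz, eval_aeval_shift _ _ hz, eval_const]
    ext i
    rw [hΘ.apply hz]
    by_cases hi : i = j
    · subst hi; simp [h z hz]
    · simp [hi]

theorem IsDiagonal.mul_eval_eq (hΘ : Θ.IsDiagonal θ) {g q : ℂ[X]} {j : Fin m}
    (h : Θ.mul (aeval (shift m) g (const m (EuclideanSpace.single j 1))) =
      aeval (shift m) q (const m (EuclideanSpace.single j 1)))
    {z : ℂ} (hz : z ∈ ball (0 : ℂ) 1) : θ j z * g.eval z = q.eval z := by
  have h1 := congrArg (fun F => eval F z j) h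
  simpa [eval_mul _ _ hz, eval_aeval_shift _ _ hz, hΘ.apply hz, mul_comm] using h1

/-- If `Θ` maps a function to a polynomial, the function is a polynomial of at most the same
degree. -/
theorem apply_eq_zero_of_mul_eq_aeval {G : H2 m} {q : ℂ[X]} {v : Cn m}
    (h : Θ.mul G = aeval (shift m) q (const m v)) {n : ℕ} (hn : q.natDegree < n) : G n = 0 := by
  refine ext_inner_left ℂ fun w => ?_
  have h1 : Θ.mul ((shift m ^ n) (const m w)) = (shift m ^ n) (Θ.mul (const m w)) := by
    simpa using Θ.mul_aeval_shift (X ^ n) (const m w)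
  -- ⟨w, G n⟩ becomes ⟨zⁿΘw, qv⟩, where the first function starts in degree n and the second ends
  -- before it.
  rw [← inner_shift_pow_const, ← Θ.mul.inner_map_map, h, h1, lp.inner_eq_tsum, inner_zero_right]
  refine (tsum_congr fun k => ?_).trans tsum_zero
  rcases lt_or_ge k n with hk | hk
  · rw [shift_pow_apply_of_lt _ hk, inner_zero_left]
  · rw [aeval_shift_const_apply, coeff_eq_zero_of_natDegree_lt (hn.trans_le hk), zero_smul,
      inner_zero_right]

/-- A diagonal inner multiplier whose entry is a quotient of polynomials in lowest terms. -/
theorem IsDiagonal.isRationalInner_of_isCoprime (hΘ : Θ.IsDiagonal θ) {g q : ℂ[X]} {j : Fin m}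
    (hq : q ≠ 0) (hroots : ∀ a, q.IsRoot a → a ∈ ball (0 : ℂ) 1) (hgq : IsCoprime q g)
    (hdeg : g.natDegree ≤ q.natDegree)
    (h : Θ.mul (aeval (shift m) g (const m (EuclideanSpace.single j 1))) =
      aeval (shift m) q (const m (EuclideanSpace.single j 1))) : IsRationalInner (θ j) := by
  refine isRationalInner_of_mul_eval_eq hq hroots hgq hdeg ?_ fun z hz => hΘ.mul_eval_eq h hz
  have hv : ‖(EuclideanSpace.single j 1 : Cn m)‖ = 1 := by simp
  ext n
  rw [coeff_mul_reflect_eq_inner hv g hdeg, coeff_mul_reflect_eq_inner hv q le_rfl,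
    ← Θ.mul.inner_map_map]
  simp only [map_mul (aeval (shift m)), Module.End.mul_apply, mul_aeval_shift, h]

/-- Reduction to lowest terms: the gcd c of q and g cancels in H² because c(S) is injective, and the
degree bound and root location pass to the cofactors. -/
theorem IsDiagonal.isRationalInner_of_mul_eq (hΘ : Θ.IsDiagonal θ) {g q : ℂ[X]} {j : Fin m}
    (hq : q ≠ 0) (hroots : ∀ a, q.IsRoot a → a ∈ ball (0 : ℂ) 1)
    (hdeg : g.natDegree ≤ q.natDegree)
    (h : Θ.mul (aeval (shift m) g (const m (EuclideanSpace.single j 1))) =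
      aeval (shift m) q (const m (EuclideanSpace.single j 1))) : IsRationalInner (θ j) := by
  have hc : EuclideanDomain.gcd q g ≠ 0 := fun h0 => hq (EuclideanDomain.gcd_eq_zero_iff.1 h0).1
  obtain ⟨q', hq'⟩ := EuclideanDomain.gcd_dvd_left q g
  obtain ⟨g', hg'⟩ := EuclideanDomain.gcd_dvd_right q g
  have hcop : IsCoprime q' g' := by
    refine ⟨EuclideanDomain.gcdA q g, EuclideanDomain.gcdB q g, mul_left_cancel₀ hc ?_⟩
    have hb := EuclideanDomain.gcd_eq_gcd_ab q g
    generalize EuclideanDomain.gcd q g = c at *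
    generalize EuclideanDomain.gcdA q g = s at *
    generalize EuclideanDomain.gcdB q g = t at *
    calc c * (s * q' + t * g') = (c * q') * s + (c * g') * t := by ring
      _ = c * 1 := by rw [← hq', ← hg', ← hb, mul_one]
  generalize EuclideanDomain.gcd q g = c at *
  subst hq' hg'
  have hq0 : q' ≠ 0 := right_ne_zero_of_mul hq
  refine hΘ.isRationalInner_of_isCoprime hq0 (fun a ha => hroots a ?_) hcop ?_
    (aeval_shift_injective hc ?_)
  · rw [IsRoot, Polynomial.eval_mul, ha.eq_zero, mul_zero]
  · rcases eq_or_ne g' 0 with rfl | hg0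
    · simp
    · rw [natDegree_mul hc hg0, natDegree_mul hc hq0] at hdeg
      omega
  · rw [← mul_aeval_shift, ← Module.End.mul_apply, ← Module.End.mul_apply, ← map_mul, ← map_mul,
      h]

/-- The entries of a diagonal inner multiplier with finite-dimensional model space are finite
Blaschke products. -/
theorem IsDiagonal.isRationalInner_of_finiteDimensional (hΘ : Θ.IsDiagonal θ)
    [FiniteDimensional ℂ Θ.modelSpace] (j : Fin m) : IsRationalInner (θ j) := by
  obtain ⟨p, hp0, hp, hpK⟩ :=
    exists_aeval_backwardShift_eq_zero fun _ => Θ.backwardShift_mem_modelSpace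
  -- Passing from the backward shift to S conjugates the coefficients, so q(S)e_j is orthogonal to
  -- the model space.
  set q := p.map (starRingEnd ℂ) with hq
  set e : Cn m := EuclideanSpace.single j 1 with he
  have hmem : aeval (shift m) q (const m e) ∈ Θ.image ⊤ := by
    rw [← modelSpace_orthogonal, Submodule.mem_orthogonal']
    intro F hF
    rw [inner_aeval_shift, hq, map_conj_map_conj, hpK F hF, inner_zero_right]
  obtain ⟨G, hG⟩ := Θ.mem_image_top.1 hmem
  -- The j-th coordinate of G; the coefficients of G vanish beyond the degree of q.
  let g : ℂ[X] := ∑ n ∈ Finset.range (q.natDegree + 1), monomial n (G n j)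
  refine hΘ.isRationalInner_of_mul_eq (g := g) (q := q) (map_conj_ne_zero hp0) (fun a ha => ?_)
    ?_ (hΘ.mul_aeval_shift_single_eq fun z hz => ?_)
  · have h1 : p.IsRoot (conj a) := by
      rw [← map_conj_map_conj p, ← hq, IsRoot, eval_map, eval₂_at_apply, ha.eq_zero, map_zero]
    simpa using hp _ h1
  · exact natDegree_sum_le_of_forall_le _ _ fun n hn =>
      (natDegree_monomial_le _).trans (Nat.lt_succ_iff.1 (Finset.mem_range.1 hn))
  · have h1 : eval G z j = g.eval z := by
      rw [eval, tsum_eq_sum (s := Finset.range (q.natDegree + 1))]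
      · simp [g, eval_finsetSum, mul_comm]
      · intro n hn
        rw [apply_eq_zero_of_mul_eq_aeval hG (by simpa using hn), smul_zero]
    rw [← h1, ← hΘ.apply hz, ← eval_mul _ _ hz, hG, eval_aeval_shift _ _ hz]
    simp [he]

/-- The space contains the isometric image ΨΘH², and the quotient by it contains a copy of K_Θ,
because Ψ K_Θ meets its own orthogonal complement only in 0. -/
theorem IsDiagonal.isHalfSpace (Ψ : InnerMultiplier m m) (hΘ : Θ.IsDiagonal θ) {j : Fin m}
    (hj : ¬ IsRationalInner (θ j)) : IsHalfSpace (Ψ.image Θ.modelSpace)ᗮ := by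
  refine ⟨Submodule.isClosed_orthogonal _, fun h => ?_, fun h => hj ?_⟩
  · have h1 : ∀ F : H2 m, Ψ.mul (Θ.mul F) ∈ (Ψ.image Θ.modelSpace)ᗮ := fun F => by
      rw [orthogonal_image_modelSpace]
      exact Submodule.mem_sup_left (Submodule.mem_map_of_mem (Θ.mem_image_top.2 ⟨F, rfl⟩))
    let A : H2 m →ₗ[ℂ] (Ψ.image Θ.modelSpace)ᗮ :=
      (Ψ.mul.toLinearMap ∘ₗ Θ.mul.toLinearMap).codRestrict _ h1
    have hA : Function.Injective A := fun F G hFG =>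
      Θ.mul.injective (Ψ.mul.injective (congrArg Subtype.val hFG))
    have := FiniteDimensional.of_injective A hA
    -- Polynomials embed in H² through p ↦ p(S)e_j, so H² is infinite-dimensional.
    let B : ℂ[X] →ₗ[ℂ] H2 m :=
      (LinearMap.applyₗ (const m (EuclideanSpace.single j 1))) ∘ₗ (aeval (shift m)).toLinearMap
    have hB : Function.Injective B := by
      rw [← LinearMap.ker_eq_bot, LinearMap.ker_eq_bot']
      intro p hp
      ext n
      have h2 := congrArg (fun F : H2 m => F n j) hp
      simpa [B, aeval_shift_const_apply] using h2
    exact Polynomial.not_finite (FiniteDimensional.of_injective B hB)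
  · let A : Θ.modelSpace →ₗ[ℂ] H2 m ⧸ (Ψ.image Θ.modelSpace)ᗮ :=
      (Ψ.image Θ.modelSpace)ᗮ.mkQ ∘ₗ Ψ.mul.toLinearMap ∘ₗ Θ.modelSpace.subtype
    have hA : Function.Injective A := by
      rw [← LinearMap.ker_eq_bot, LinearMap.ker_eq_bot']
      intro F hF
      have h1 : Ψ.mul (F : H2 m) ∈ (Ψ.image Θ.modelSpace)ᗮ :=
        (Submodule.Quotient.mk_eq_zero _).1 hF
      have h2 := h1 _ (Submodule.mem_map_of_mem (f := Ψ.mul.toLinearMap) F.2)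
      exact Subtype.ext (Ψ.mul.injective ((inner_self_eq_zero.1 h2).trans (map_zero _).symm))
    have := FiniteDimensional.of_injective A hA
    exact hΘ.isRationalInner_of_finiteDimensional j

end InnerMultiplier
end HardyShift

/-! ### The proposition -/

theorem mainTheorem6 (m : ℕ) (Ψ : HardyShift.InnerMultiplier m m) (ψ : Fin m → ℂ → ℂ)
    (hΨ : Ψ.IsDiagonal ψ) :
    (∀ (r : ℕ), r ≤ m → ∀ Θ : HardyShift.InnerMultiplier r m,
      (Ψ.image Θ.modelSpace)ᗮ = Ψ.image (Θ.image ⊤) ⊔ Ψ.modelSpace ∧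
      Ψ.image (Θ.image ⊤) ⟂ Ψ.modelSpace ∧
      HardyShift.IsAlmostInvariantWith (HardyShift.shift m) (Ψ.image Θ.modelSpace)ᗮ m ∧
      (HardyShift.IsMinimalDefect (HardyShift.shift m) (Ψ.image Θ.modelSpace)ᗮ m ↔
        (∀ i, ¬ HardyShift.IsConstOnDisc (ψ i)) ∧
        ∀ v : HardyShift.Cn r, v ≠ 0 → ¬ HardyShift.IsConstOnDisc (fun z => Θ.toFun z v))) ∧
    (∀ (Θ : HardyShift.InnerMultiplier m m) (θ : Fin m → ℂ → ℂ), Θ.IsDiagonal θ →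
      (∃ j, ¬ HardyShift.IsRationalInner (θ j)) →
      HardyShift.IsHalfSpace (Ψ.image Θ.modelSpace)ᗮ ∧
      HardyShift.IsAlmostInvariantWith (HardyShift.shift m) (Ψ.image Θ.modelSpace)ᗮ m ∧
      (HardyShift.IsMinimalDefect (HardyShift.shift m) (Ψ.image Θ.modelSpace)ᗮ m ↔
        (∀ i, ¬ HardyShift.IsConstOnDisc (ψ i)) ∧ ∀ i, ¬ HardyShift.IsConstOnDisc (θ i))) := by
  refine ⟨fun r _ Θ => ⟨Ψ.orthogonal_image_modelSpace Θ, Ψ.image_isOrtho_modelSpace _,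
    Ψ.isAlmostInvariantWith Θ, ?_⟩, fun Θ θ hΘ ⟨j, hj⟩ =>
    ⟨hΘ.isHalfSpace Ψ hj, Ψ.isAlmostInvariantWith Θ, ?_⟩⟩
  · rw [hΨ.forall_not_isConstOnDisc_iff]
    exact Ψ.isMinimalDefect_iff Θ
  · rw [hΨ.forall_not_isConstOnDisc_iff, hΘ.forall_not_isConstOnDisc_iff]
    exact Ψ.isMinimalDefect_iff Θ
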